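/- Let $\tau=\frac{1+\sqrt5}{2}$, $\tau'=\frac{1-\sqrt5}{2}$, $\mathcal L=\{(m+n\tau,\,m+n\tau'):m,n\in\mathbb Z\}\subseteq\mathbb R^2$, and let $\mathbf{Fib}=\{x : (x,y)\in\mathcal L \text{ for some } y\in[-1,\tau-1)\}$ be the Fibonacci model set. Let $\mathcal L^0=\{y\in\mathbb R^2: e^{2\pi i x\cdot y}=1 \text{ for all } x\in\mathcal L\}=\left\{\left(\frac{n-m\tau'}{\sqrt5},\frac{m\tau-n}{\sqrt5}\right):m,n\in\mathbb Z\right\}$ be the dual lattice. For $k$ in its first projection let $k^\star$ be the unique real number with $(k,k^\star)\in\mathcal L^0$, and for $J\subseteq\mathbb R$ put $\curlywedge^\star(J)=\{k : (k,k^\star)\in\mathcal L^0,\ k^\star\in J\}$. Let $\Lambda\subseteq\mathbf{Fib}$ be any subset and let $\mathcal A=(A_n)_n$ be a van Hove sequence of compact subsets of $\mathbb R$ (that is, $|A_n|>0$ and $|\partial^K(A_n)|/|A_n|\to0$ for every non-empty compact $K\subseteq\mathbb R$, where $\partial^K(B)=((K+B)\setminus B^\circ)\cup((-K+\overline{\mathbb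 R\setminus B})\cap B)$) along which the autocorrelation of $\Lambda$ exists, that is, the limit $$\eta(z)=\lim_{n}\frac{1}{|A_n|}\,\#\{(x,y)\in(\Lambda\cap A_n)^2 : x-y=z\}$$ exists for every $z\in\Lambda-\Lambda$. Let $\gamma_\Lambda=\sum_{z\in\Lambda-\Lambda}\eta(z)\delta_z$ be the autocorrelation, and let the diffraction measure $\widehat{\gamma_\Lambda}$ be its Fourier transform, that is, the positive Radon measure on $\mathbb R$ such that for all $\varphi\in C_c(\mathbb R)$ one has $\check\varphi\in L^2(\widehat{\gamma_\Lambda})$ and $\gamma_\Lambda(\varphi*\tilde\varphi)=\widehat{\gamma_\Lambda}(|\check\varphi|^2)$, where $\check\varphi(k)=\int_{\mathbb R} e^{2\pi i kx}\varphi(x)\,dx$ and $\tilde\varphi(x)=\overline{\varphi(-x)}$. One says that $\Lambda$ has a Bragg peak at $k$, of intensity $\widehat{\gamma_\Lambda}(\{k\})$, if $\widehat{\gamma_\Lambda}(\{k\})>0$. If $I:=\widehat{\gamma_\Lambda}(\{0\})>0$, then $\Lambda$ has a Bragg peak at every $k\in\curlywedge^\star\left(\left(-\frac{1}{2\pi\tau},\frac{1}{2\pi\tau}\right)\right)$,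 and its intensity satisfies $$\widehat{\gamma_\Lambda}(\{k\})\ \ge\ (1-2\pi|k^\star|\tau)\,I\ >\ 0 .$$ -/

import Mathlib

open Filter MeasureTheory Topology
open scoped Pointwise FourierTransform Convolution

noncomputable section

namespace FibDiffraction

/-! ### Cut-and-project sets in `ℝ × ℝ` -/

/-- For a lattice `L ⊆ ℝ × ℝ` and a window `W ⊆ ℝ`, the set `π₁ (L ∩ (ℝ × W))`. -/
def modelSet (L : Set (ℝ × ℝ)) (W : Set ℝ) : Set ℝ :=
  {x | ∃ y ∈ W, (x, y) ∈ L}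

/-- The star map of `L`: for `x ∈ π₁ L` the element `x⋆` with `(x, x⋆) ∈ L`. It is unique when
`π₁` is injective on `L`; outside `π₁ L` the value is arbitrary and is never used. -/
def starMap (L : Set (ℝ × ℝ)) (x : ℝ) : ℝ :=
  Classical.epsilon fun y => (x, y) ∈ L

/-- The lattice `{(m + n τ, m + n τ') : m, n ∈ ℤ}`, with `τ = (1 + √5) / 2` and
`τ' = (1 - √5) / 2`. -/
def fibLattice : Set (ℝ × ℝ) :=
  {p | ∃ m n : ℤ, p = ((m : ℝ) + n * Real.goldenRatio, (m : ℝ) + n * Real.goldenConj)}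

/-- The dual lattice (annihilator) `{y ∈ ℝ² : exp (2 π i x · y) = 1 for all x ∈ L}`. -/
def dualLattice (L : Set (ℝ × ℝ)) : Set (ℝ × ℝ) :=
  {y | ∀ x ∈ L,
    Complex.exp (2 * Real.pi * Complex.I * ((x.1 * y.1 + x.2 * y.2 : ℝ) : ℂ)) = 1}

/-- The Fibonacci model set: all `x ∈ ℤ[τ]` with `x⋆ ∈ [-1, τ - 1)`. -/
def Fib : Set ℝ :=
  modelSet fibLattice (Set.Ico (-1) (Real.goldenRatio - 1))

/-- The model sets of the dual lattice of `fibLattice`. -/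
def dualModelSet (J : Set ℝ) : Set ℝ :=
  modelSet (dualLattice fibLattice) J

/-- The star map of the dual lattice of `fibLattice`. -/
def dualStar : ℝ → ℝ :=
  starMap (dualLattice fibLattice)

lemma mem_dualLattice_fib_iff (p : ℝ × ℝ) :
    p ∈ dualLattice fibLattice ↔
      ∃ m n : ℤ, p = ((n - m * Real.goldenConj) / √5, (m * Real.goldenRatio - n) / √5) := by
  have h5 : (√5 : ℝ) ≠ 0 := by positivity
  have hs : (√5 : ℝ) * √5 = 5 := Real.mul_self_sqrt (by norm_num)
  have hpi : (2 * Real.pi * Complex.I : ℂ) ≠ 0 := Complex.two_pi_I_ne_zero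
  have key : ∀ r : ℝ, Complex.exp (2 * Real.pi * Complex.I * (r : ℂ)) = 1 ↔
      ∃ n : ℤ, r = n := by
    intro r
    rw [Complex.exp_eq_one_iff]
    refine exists_congr fun n => ?_
    rw [mul_comm (n : ℂ), mul_right_inj' hpi]
    exact_mod_cast Iff.rfl
  constructor
  · intro hp
    obtain ⟨a, ha⟩ := (key _).1 (hp (1, 1) ⟨1, 0, by simp⟩)
    obtain ⟨b, hb⟩ := (key _).1 (hp (Real.goldenRatio, Real.goldenConj) ⟨0, 1, by simp⟩)
    refine ⟨a, b, Prod.ext ?_ ?_⟩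
    · simp only [Real.goldenRatio, Real.goldenConj] at *
      rw [eq_div_iff h5, ← ha, ← hb]
      ring
    · simp only [Real.goldenRatio, Real.goldenConj] at *
      rw [eq_div_iff h5, ← ha, ← hb]
      ring
  · rintro ⟨m, n, rfl⟩ _ ⟨a, b, rfl⟩
    refine (key _).2 ⟨a * m + b * n, ?_⟩
    push_cast
    simp only [Real.goldenRatio, Real.goldenConj]
    field_simp
    ring

lemma mem_dualModelSet_iff (J : Set ℝ) (k : ℝ) :
    k ∈ dualModelSet J ↔
      ∃ m n : ℤ, k = (n - m * Real.goldenConj) / √5 ∧ (m * Real.goldenRatio - n) / √5 ∈ J := by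
  constructor
  · rintro ⟨y, hy, h⟩
    obtain ⟨m, n, hp⟩ := (mem_dualLattice_fib_iff _).1 h
    rw [Prod.mk.injEq] at hp
    exact ⟨m, n, hp.1, hp.2 ▸ hy⟩
  · rintro ⟨m, n, rfl, h⟩
    exact ⟨_, h, (mem_dualLattice_fib_iff _).2 ⟨m, n, rfl⟩⟩

lemma dualStar_eq (m n : ℤ) :
    dualStar ((n - m * Real.goldenConj) / √5) = (m * Real.goldenRatio - n) / √5 := by
  have h5 : (√5 : ℝ) ≠ 0 := by positivity
  have h : ((n - m * Real.goldenConj) / √5, dualStar ((n - m * Real.goldenConj) / √5)) ∈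
      dualLattice fibLattice :=
    Classical.epsilon_spec (p := fun y => ((n - m * Real.goldenConj) / √5, y) ∈
      dualLattice fibLattice) ⟨_, (mem_dualLattice_fib_iff _).2 ⟨m, n, rfl⟩⟩
  obtain ⟨a, b, hp⟩ := (mem_dualLattice_fib_iff _).1 h
  rw [Prod.mk.injEq] at hp
  obtain ⟨h1, h2⟩ := hp
  rw [div_left_inj' h5] at h1
  have ham : a = m := by
    by_contra hne
    have hne' : ((a - m : ℤ) : ℝ) ≠ 0 := by exact_mod_cast sub_ne_zero.2 hne
    refine Real.goldenConj_irrational ⟨((b - n : ℤ) : ℚ) / ((a - m : ℤ) : ℚ), ?_⟩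
    push_cast at hne' ⊢
    rw [div_eq_iff hne']
    linarith
  subst ham
  have hbn : (b : ℝ) = n := by linarith
  rw [h2, hbn]

/-! ### Autocorrelation and diffraction -/

/-- The `K`-boundary of a set `B ⊆ ℝ`. -/
def kBoundary (K B : Set ℝ) : Set ℝ :=
  ((K + B) \ interior B) ∪ ((-K + closure Bᶜ) ∩ B)

/-- Van Hove sequences of compact subsets of `ℝ` (of positive measure, so that the quotients
make sense). -/
structure IsVanHove (A : ℕ → Set ℝ) : Prop where
  isCompact : ∀ n, IsCompact (A n)
  volume_pos : ∀ n, 0 < volume (A n)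
  tendsto_boundary : ∀ K : Set ℝ, IsCompact K → K.Nonempty →
    Tendsto (fun n => volume (kBoundary K (A n)) / volume (A n)) atTop (𝓝 0)

/-- The number of pairs `x, y ∈ Λ ∩ B` with `x - y = z`. These are finitely many when `Λ` is locally
finite and `B` is compact. -/
def pairCount (Λ B : Set ℝ) (z : ℝ) : ℕ :=
  {p : ℝ × ℝ | p.1 ∈ Λ ∩ B ∧ p.2 ∈ Λ ∩ B ∧ p.1 - p.2 = z}.ncard

/-- The autocorrelation of the Dirac comb `∑_{x ∈ Λ} δ_x` along `A` exists and equals `γ`: the limits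
`η z = lim_n |A_n|⁻¹ #{(x, y) ∈ (Λ ∩ A_n)² : x - y = z}` exist for all `z ∈ Λ - Λ`, and
`γ = ∑_{z ∈ Λ - Λ} η z δ_z`. -/
def IsAutocorrelation (A : ℕ → Set ℝ) (Λ : Set ℝ) (γ : Measure ℝ) : Prop :=
  ∃ η : ℝ → ℝ,
    (∀ z ∈ Λ - Λ,
      Tendsto (fun n => (pairCount Λ (A n) z : ℝ) / volume.real (A n)) atTop (𝓝 (η z))) ∧
    γ = Measure.sum fun z : ↥(Λ - Λ) => ENNReal.ofReal (η z) • Measure.dirac (z : ℝ)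

/-- The positive Radon measure `ν` on `ℝ` is the Fourier transform of the (positive) measure `γ`: for
all `φ ∈ C_c(ℝ)`, with `φ~(x) = conj (φ (-x))`, the inverse Fourier transform of `φ` lies in `L²(ν)`,
and `γ(φ * φ~) = ν(|𝓕⁻ φ|²)`. The dual group of `ℝ` is identified with `ℝ` through the characters
`x ↦ exp (2 π i k x)`. -/
structure IsFourierTransform (γ ν : Measure ℝ) : Prop where
  locallyFinite : IsLocallyFiniteMeasure ν
  memLp : ∀ φ : ℝ → ℂ, Continuous φ → HasCompactSupport φ → MemLp (𝓕⁻ φ) 2 ν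
  integral_eq : ∀ φ : ℝ → ℂ, Continuous φ → HasCompactSupport φ →
    ∫ x, (φ ⋆[ContinuousLinearMap.mul ℝ ℂ, volume] fun y => (starRingEnd ℂ) (φ (-y))) x ∂γ =
      ((∫ k, ‖𝓕⁻ φ k‖ ^ 2 ∂ν : ℝ) : ℂ)

/-- `γhat` is the diffraction measure of `Λ` with respect to `A`: the Fourier transform of the
autocorrelation of `Λ`. -/
def IsDiffraction (A : ℕ → Set ℝ) (Λ : Set ℝ) (γhat : Measure ℝ) : Prop :=
  ∃ γ : Measure ℝ, IsAutocorrelation A Λ γ ∧ IsFourierTransform γ γhat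

/-- A set with diffraction measure `γhat` has a Bragg peak at `k` if `γhat` has an atom there; its
intensity is `γhat {k}`. -/
def HasBraggPeak (γhat : Measure ℝ) (k : ℝ) : Prop :=
  0 < γhat {k}

end FibDiffraction

end

/-!
For a test function `f ≥ 0` let `G = f * f~ ≥ 0`. Modulating `f` by `k` multiplies `G` by the
character `x ↦ exp (-2 π i k x)`, so the identity defining the Fourier transform `γhat` of `γ` gives
`∫ |𝓕⁻ f (v - k)|² dγhat(v) = ∫ cos (2 π k x) G(x) dγ(x)`. Suppose that every `x` charged by `γ` has
a companion `y` with `(x, y) ∈ L` and `|y| ≤ d`, and let `(k, l)` lie in the dual of `L`. Then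
`x k + y l` is an integer, so `cos (2 π k x) = cos (2 π l y) ≥ 1 - 2 π |l| d`, and the integral for
`k` is at least `1 - 2 π |l| d` times the integral for `0`.

To pass from these integrals to atoms, replace `f` by its convolution with the dilation
`x ↦ f (x / t) / t`. The inverse Fourier transform becomes `𝓕⁻ f (v) * 𝓕⁻ f (t v)`, which stays
dominated by a multiple of `𝓕⁻ f` and, by the Riemann-Lebesgue lemma, vanishes off the origin as
`t → ∞`. By dominated convergence the integrals for `k` and `0` tend to the same multiple of
`γhat {k}` and `γhat {0}`. For subsets of `Fib` the companions of differences are bounded by the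
length `d = τ` of the window.
-/

noncomputable section

namespace FibDiffraction

open scoped ComplexOrder

section TestFunctions

variable {E : Type*} [NormedAddCommGroup E] [NormedSpace ℂ E]

/-- The modulation of `f` by the character of frequency `-k`. The sign makes the inverse Fourier
transform of `modulate k f` that of `f` translated by `k`. -/
def modulate (k : ℝ) (f : ℝ → E) (x : ℝ) : E :=
  𝐞 (-(k * x)) • f x

/-- The dilation of `f` by `t > 0`, normalised to preserve the integral. It compresses the inverse
Fourier transform of `f` towards the origin by the factor `t`. -/
def dilate (t : ℝ) (f : ℝ → E) (x : ℝ) : E :=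
  t⁻¹ • f (t⁻¹ * x)

/-- The convolution of `f` with its dilation by `t`. As `t → ∞` its inverse Fourier transform
concentrates at the origin while staying dominated by that of `f`, so that it detects atoms. -/
def spread (t : ℝ) (f : ℝ → ℂ) : ℝ → ℂ :=
  f ⋆[ContinuousLinearMap.mul ℂ ℂ, volume] dilate t f

/-- The convolution `f * f~` with `f~(x) = conj (f (-x))`, against which the autocorrelation measure
is tested in `IsFourierTransform`. -/
def selfConvolution (f : ℝ → ℂ) : ℝ → ℂ :=
  f ⋆[ContinuousLinearMap.mul ℝ ℂ, volume] fun y => (starRingEnd ℂ) (f (-y))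

lemma continuous_modulate {f : ℝ → E} (hf : Continuous f) (k : ℝ) : Continuous (modulate k f) :=
  (Real.continuous_fourierChar.comp (by fun_prop)).smul hf

lemma hasCompactSupport_modulate {f : ℝ → E} (hf : HasCompactSupport f) (k : ℝ) :
    HasCompactSupport (modulate k f) :=
  hf.smul_left (f := fun x => 𝐞 (-(k * x)))

lemma integrable_modulate {f : ℝ → E} {μ : Measure ℝ} (hf : Integrable f μ) (k : ℝ) :
    Integrable (modulate k f) μ := by
  have hchar : Continuous fun x => 𝐞 (-(k * x)) := Real.continuous_fourierChar.comp (by fun_prop)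
  exact hf.mono (hchar.aestronglyMeasurable.smul hf.aestronglyMeasurable)
    (.of_forall fun x => (Circle.norm_smul _ _).le)

lemma fourierInv_modulate (k : ℝ) (f : ℝ → E) :
    𝓕⁻ (modulate k f) = fun v => 𝓕⁻ f (v - k) := by
  ext v
  simp only [Real.fourierInv_eq, modulate, smul_smul, ← AddChar.map_add_eq_mul]
  congr! 4 with x
  simp only [RCLike.inner_apply, conj_trivial]
  ring

lemma re_modulate {f : ℝ → ℂ} {x : ℝ} (hf : 0 ≤ f x) (k : ℝ) :
    (modulate k f x).re = Real.cos (2 * Real.pi * k * x) * (f x).re := by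
  have him : (f x).im = 0 := (Complex.nonneg_iff.1 hf).2.symm
  rw [modulate, Circle.smul_def, smul_eq_mul, Complex.mul_re, him, mul_zero, sub_zero,
    Real.fourierChar_apply, Complex.exp_ofReal_mul_I_re, ← Real.cos_neg]
  ring_nf

lemma selfConvolution_modulate (k : ℝ) (f : ℝ → ℂ) :
    selfConvolution (modulate k f) = modulate k (selfConvolution f) := by
  ext x
  simp only [selfConvolution, modulate, convolution_def, ContinuousLinearMap.mul_apply',
    Circle.smul_def, smul_eq_mul, map_mul, ← Circle.coe_inv_eq_conj, ← AddChar.map_neg_eq_inv,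
    ← integral_const_mul]
  refine integral_congr_ae (.of_forall fun t => ?_)
  beta_reduce
  rw [show -(k * x) = -(k * t) + -(-(k * -(x - t))) by ring, AddChar.map_add_eq_mul, Circle.coe_mul]
  ring

lemma selfConvolution_nonneg {f : ℝ → ℂ} (hf : 0 ≤ f) : 0 ≤ selfConvolution f :=
  fun _ => integral_nonneg fun _ => mul_nonneg (hf _) (star_nonneg_iff.2 (hf _))

lemma continuous_dilate {f : ℝ → E} (hf : Continuous f) (t : ℝ) : Continuous (dilate t f) := by
  unfold dilate
  fun_prop

lemma hasCompactSupport_dilate {f : ℝ → E} (hf : HasCompactSupport f) {t : ℝ} (ht : t ≠ 0) :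
    HasCompactSupport (dilate t f) :=
  (hf.comp_homeomorph (Homeomorph.mulLeft₀ t⁻¹ (inv_ne_zero ht))).smul_left (f := fun _ => t⁻¹)

lemma dilate_nonneg {f : ℝ → ℂ} (hf : 0 ≤ f) {t : ℝ} (ht : 0 ≤ t) : 0 ≤ dilate t f :=
  fun _ => smul_nonneg (inv_nonneg.2 ht) (hf _)

lemma fourierInv_dilate {t : ℝ} (ht : 0 < t) (f : ℝ → E) (v : ℝ) :
    𝓕⁻ (dilate t f) v = 𝓕⁻ f (t * v) := by
  have hscale := Measure.integral_comp_inv_mul_left (fun x => 𝐞 (x * (t * v)) • f x) t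
  simp only [Real.fourierInv_eq, dilate, RCLike.inner_apply, conj_trivial, smul_comm _ t⁻¹,
    integral_smul]
  rw [inv_smul_eq_iff₀ ht.ne']
  convert hscale using 4 with x
  · congr 1
    field_simp
  · exact (abs_of_pos ht).symm
  · rw [mul_comm]

lemma fourierInv_apply_zero (f : ℝ → E) : 𝓕⁻ f 0 = ∫ x, f x := by
  simp [Real.fourierInv_eq]

lemma norm_fourierInv_le_integral_norm (f : ℝ → E) (v : ℝ) : ‖𝓕⁻ f v‖ ≤ ∫ x, ‖f x‖ :=
  VectorFourier.norm_fourierIntegral_le_integral_norm _ _ _ _ _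

lemma tendsto_fourierInv_cocompact (f : ℝ → E) : Tendsto (𝓕⁻ f) (cocompact ℝ) (𝓝 0) := by
  rw [Real.fourierInv_eq_fourier_comp_neg]
  exact Real.zero_at_infty_fourier _

lemma continuous_spread {f : ℝ → ℂ} (hf : Continuous f) (hfc : HasCompactSupport f) (t : ℝ) :
    Continuous (spread t f) :=
  hfc.continuous_convolution_left _ hf (continuous_dilate hf t).locallyIntegrable

lemma hasCompactSupport_spread {f : ℝ → ℂ} (hf : HasCompactSupport f) {t : ℝ} (ht : t ≠ 0) :
    HasCompactSupport (spread t f) :=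
  hf.convolution _ (hasCompactSupport_dilate hf ht)

lemma spread_nonneg {f : ℝ → ℂ} (hf : 0 ≤ f) {t : ℝ} (ht : 0 ≤ t) : 0 ≤ spread t f :=
  fun _ => integral_nonneg fun _ => mul_nonneg (hf _) (dilate_nonneg hf ht _)

lemma fourierInv_spread {f : ℝ → ℂ} (hf : Continuous f) (hfc : HasCompactSupport f) {t : ℝ}
    (ht : 0 < t) (v : ℝ) : 𝓕⁻ (spread t f) v = 𝓕⁻ f v * 𝓕⁻ f (t * v) := by
  have hdilate : Integrable (dilate t f) :=
    (continuous_dilate hf t).integrable_of_hasCompactSupport (hasCompactSupport_dilate hfc ht.ne')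
  rw [Real.fourierInv_eq_fourier_neg, spread, Real.fourier_mul_convolution_eq
    (hf.integrable_of_hasCompactSupport hfc) hdilate, ← Real.fourierInv_eq_fourier_neg,
    ← Real.fourierInv_eq_fourier_neg, fourierInv_dilate ht]

lemma tendsto_fourierInv_spread {f : ℝ → ℂ} (hf : Continuous f) (hfc : HasCompactSupport f)
    (v : ℝ) :
    Tendsto (fun t => 𝓕⁻ (spread t f) v) atTop
      (𝓝 (({0} : Set ℝ).indicator (fun _ => (∫ x, f x) ^ 2) v)) := by
  have hfactor : (fun t => 𝓕⁻ f v * 𝓕⁻ f (t * v)) =ᶠ[atTop] fun t => 𝓕⁻ (spread t f) v := by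
    filter_upwards [eventually_gt_atTop 0] with t ht
    exact (fourierInv_spread hf hfc ht v).symm
  refine Tendsto.congr' hfactor ?_
  rcases eq_or_ne v 0 with rfl | hv
  · simp [fourierInv_apply_zero, sq]
  · rw [Set.indicator_of_notMem (Set.notMem_singleton_iff.2 hv), ← mul_zero (𝓕⁻ f v)]
    have hscale : Tendsto (fun t : ℝ => t * v) atTop (cocompact ℝ) :=
      (Homeomorph.mulRight₀ v hv).isClosedEmbedding.tendsto_cocompact.mono_left
        atTop_le_cocompact
    exact ((tendsto_fourierInv_cocompact f).comp hscale).const_mul _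

end TestFunctions

section FourierTransformOfMeasure

variable {γ ν : Measure ℝ} {f : ℝ → ℂ}

lemma IsFourierTransform.integrable_norm_fourierInv_sub_sq (h : IsFourierTransform γ ν)
    (hf : Continuous f) (hfc : HasCompactSupport f) (k : ℝ) :
    Integrable (fun v => ‖𝓕⁻ f (v - k)‖ ^ 2) ν := by
  have hmem := h.memLp _ (continuous_modulate hf k) (hasCompactSupport_modulate hfc k)
  rw [fourierInv_modulate] at hmem
  exact hmem.integrable_norm_pow two_ne_zero

lemma IsFourierTransform.integral_modulate_selfConvolution (h : IsFourierTransform γ ν)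
    (hf : Continuous f) (hfc : HasCompactSupport f) (k : ℝ) :
    ∫ x, modulate k (selfConvolution f) x ∂γ = ((∫ v, ‖𝓕⁻ f (v - k)‖ ^ 2 ∂ν : ℝ) : ℂ) := by
  rw [← selfConvolution_modulate]
  have hplancherel := h.integral_eq _ (continuous_modulate hf k) (hasCompactSupport_modulate hfc k)
  rwa [fourierInv_modulate] at hplancherel

lemma IsFourierTransform.integral_norm_fourierInv_sub_sq (h : IsFourierTransform γ ν)
    (hf : Continuous f) (hfc : HasCompactSupport f) (hf0 : 0 ≤ f)
    (hint : Integrable (selfConvolution f) γ) (k : ℝ) :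
    ∫ v, ‖𝓕⁻ f (v - k)‖ ^ 2 ∂ν =
      ∫ x, Real.cos (2 * Real.pi * k * x) * (selfConvolution f x).re ∂γ := by
  rw [← Complex.ofReal_re (∫ v, _ ∂ν), ← h.integral_modulate_selfConvolution hf hfc k]
  simp only [← re_modulate (selfConvolution_nonneg hf0 _)]
  exact (integral_re (integrable_modulate hint k)).symm

lemma IsFourierTransform.mul_integral_norm_fourierInv_sq_le (h : IsFourierTransform γ ν)
    (hf : Continuous f) (hfc : HasCompactSupport f) (hf0 : 0 ≤ f)
    {k c : ℝ} (hk : ∀ᵐ x ∂γ, c ≤ Real.cos (2 * Real.pi * k * x)) :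
    c * ∫ v, ‖𝓕⁻ f v‖ ^ 2 ∂ν ≤ ∫ v, ‖𝓕⁻ f (v - k)‖ ^ 2 ∂ν := by
  by_cases hint : Integrable (selfConvolution f) γ
  · have hre : ∀ x, 0 ≤ (selfConvolution f x).re := fun x =>
      (Complex.nonneg_iff.1 (selfConvolution_nonneg hf0 x)).1
    have hzero := h.integral_norm_fourierInv_sub_sq hf hfc hf0 hint 0
    simp only [sub_zero, mul_zero, zero_mul, Real.cos_zero, one_mul] at hzero
    rw [h.integral_norm_fourierInv_sub_sq hf hfc hf0 hint k, hzero, ← integral_const_mul]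
    refine integral_mono_ae (hint.re.const_mul c) ?_ ?_
    · simp only [← re_modulate (selfConvolution_nonneg hf0 _)]
      exact (integrable_modulate hint k).re
    · filter_upwards [hk] with x hx
      exact mul_le_mul_of_nonneg_right hx (hre x)
  · have hzero : ∫ v, ‖𝓕⁻ f v‖ ^ 2 ∂ν = 0 := by
      exact_mod_cast (h.integral_eq f hf hfc).symm.trans (integral_undef hint)
    rw [hzero, mul_zero]
    positivity

lemma IsFourierTransform.tendsto_integral_norm_fourierInv_spread_sq (h : IsFourierTransform γ ν)
    (hf : Continuous f) (hfc : HasCompactSupport f) (k : ℝ) :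
    Tendsto (fun t => ∫ v, ‖𝓕⁻ (spread t f) (v - k)‖ ^ 2 ∂ν) atTop
      (𝓝 (‖∫ x, f x‖ ^ 4 * ν.real {k})) := by
  have hlim : ‖∫ x, f x‖ ^ 4 * ν.real {k} =
      ∫ v, ‖({0} : Set ℝ).indicator (fun _ => (∫ x, f x) ^ 2) (v - k)‖ ^ 2 ∂ν := by
    rw [mul_comm, ← smul_eq_mul, ← integral_indicator_const _ (measurableSet_singleton k)]
    congr with v
    by_cases hv : v = k
    · simp [hv, ← pow_mul]
    · simp [hv, sub_eq_zero]
  rw [hlim]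
  refine tendsto_integral_filter_of_dominated_convergence
    (fun v => (‖𝓕⁻ f (v - k)‖ * ∫ x, ‖f x‖) ^ 2) ?_ ?_ ?_ ?_
  · filter_upwards [eventually_gt_atTop 0] with t ht
    exact (h.integrable_norm_fourierInv_sub_sq (continuous_spread hf hfc t)
      (hasCompactSupport_spread hfc ht.ne') k).aestronglyMeasurable
  · filter_upwards [eventually_gt_atTop 0] with t ht
    refine .of_forall fun v => ?_
    rw [Real.norm_of_nonneg (by positivity), fourierInv_spread hf hfc ht, norm_mul]
    gcongr
    exact norm_fourierInv_le_integral_norm f _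
  · simpa only [mul_pow] using (h.integrable_norm_fourierInv_sub_sq hf hfc k).mul_const _
  · exact .of_forall fun v => (tendsto_fourierInv_spread hf hfc (v - k)).norm.pow 2

lemma IsFourierTransform.mul_measureReal_singleton_zero_le (h : IsFourierTransform γ ν)
    {k c : ℝ} (hk : ∀ᵐ x ∂γ, c ≤ Real.cos (2 * Real.pi * k * x)) :
    c * ν.real {0} ≤ ν.real {k} := by
  let φ : ContDiffBump (0 : ℝ) := ⟨1, 2, one_pos, one_lt_two⟩
  let f : ℝ → ℂ := fun x => φ x
  have hf : Continuous f := Complex.continuous_ofReal.comp φ.continuous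
  have hfc : HasCompactSupport f := φ.hasCompactSupport.comp_left Complex.ofReal_zero
  have hf0 : 0 ≤ f := fun x => Complex.zero_le_real.2 φ.nonneg
  have hmass : 0 < ‖∫ x, f x‖ ^ 4 := by
    rw [integral_complex_ofReal]
    exact pow_pos (norm_pos_iff.2 (Complex.ofReal_ne_zero.2 φ.integral_pos.ne')) 4
  have hle : c * (‖∫ x, f x‖ ^ 4 * ν.real {0}) ≤ ‖∫ x, f x‖ ^ 4 * ν.real {k} := by
    refine le_of_tendsto_of_tendsto
      ((h.tendsto_integral_norm_fourierInv_spread_sq hf hfc 0).const_mul c)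
      (h.tendsto_integral_norm_fourierInv_spread_sq hf hfc k) ?_
    filter_upwards [eventually_gt_atTop 0] with t ht
    simpa only [sub_zero] using h.mul_integral_norm_fourierInv_sq_le (continuous_spread hf hfc t)
      (hasCompactSupport_spread hfc ht.ne') (spread_nonneg hf0 ht.le) hk
  rw [mul_left_comm] at hle
  exact le_of_mul_le_mul_left hle hmass

end FourierTransformOfMeasure

section ModelSets

variable {L : Set (ℝ × ℝ)}

lemma modelSet_mono (L : Set (ℝ × ℝ)) {W W' : Set ℝ} (hW : W ⊆ W') :
    modelSet L W ⊆ modelSet L W' :=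
  fun _ ⟨y, hy, hxy⟩ => ⟨y, hW hy, hxy⟩

lemma countable_modelSet (hL : L.Countable) (W : Set ℝ) : (modelSet L W).Countable := by
  refine (hL.image Prod.fst).mono ?_
  rintro x ⟨y, -, hxy⟩
  exact ⟨(x, y), hxy, rfl⟩

lemma modelSet_sub_modelSet_subset (hL : L - L ⊆ L) (W W' : Set ℝ) :
    modelSet L W - modelSet L W' ⊆ modelSet L (W - W') := by
  rintro _ ⟨x, ⟨x', hx', hx⟩, y, ⟨y', hy', hy⟩, rfl⟩
  exact ⟨x' - y', Set.sub_mem_sub hx' hy', hL (Set.sub_mem_sub hx hy)⟩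

lemma exists_int_eq_of_mem_dualLattice {p q : ℝ × ℝ} (hp : p ∈ L) (hq : q ∈ dualLattice L) :
    ∃ n : ℤ, p.1 * q.1 + p.2 * q.2 = n := by
  obtain ⟨n, hn⟩ := Complex.exp_eq_one_iff.1 (hq p hp)
  have hn' := mul_left_cancel₀ Complex.two_pi_I_ne_zero (hn.trans (mul_comm _ _))
  exact ⟨n, by exact_mod_cast hn'⟩

lemma cos_eq_cos_of_mem_dualLattice {x y k l : ℝ} (hxy : (x, y) ∈ L)
    (hkl : (k, l) ∈ dualLattice L) :
    Real.cos (2 * Real.pi * k * x) = Real.cos (2 * Real.pi * l * y) := by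
  obtain ⟨n, hn⟩ := exists_int_eq_of_mem_dualLattice hxy hkl
  rw [← Real.cos_int_mul_two_pi_sub _ n, ← hn]
  ring_nf

lemma one_sub_abs_le_cos (θ : ℝ) : 1 - |θ| ≤ Real.cos θ := by
  have hlip := (le_abs_self _).trans (Real.abs_cos_sub_cos_le 0 θ)
  rw [Real.cos_zero, zero_sub, abs_neg] at hlip
  linarith

lemma one_sub_le_cos_of_mem_modelSet {x k l d : ℝ} (hx : x ∈ modelSet L (Set.Icc (-d) d))
    (hkl : (k, l) ∈ dualLattice L) :
    1 - 2 * Real.pi * |l| * d ≤ Real.cos (2 * Real.pi * k * x) := by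
  obtain ⟨y, hy, hxy⟩ := hx
  have hyd : |y| ≤ d := abs_le.2 hy
  calc 1 - 2 * Real.pi * |l| * d ≤ 1 - 2 * Real.pi * |l| * |y| := by gcongr
    _ = 1 - |2 * Real.pi * l * y| := by rw [abs_mul, abs_mul, abs_of_pos Real.two_pi_pos]
    _ ≤ Real.cos (2 * Real.pi * l * y) := one_sub_abs_le_cos _
    _ = Real.cos (2 * Real.pi * k * x) := (cos_eq_cos_of_mem_dualLattice hxy hkl).symm

end ModelSets

section Fibonacci

lemma countable_fibLattice : fibLattice.Countable := by
  refine (Set.countable_range fun p : ℤ × ℤ =>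
    ((p.1 : ℝ) + p.2 * Real.goldenRatio, (p.1 : ℝ) + p.2 * Real.goldenConj)).mono ?_
  rintro _ ⟨m, n, rfl⟩
  exact ⟨(m, n), rfl⟩

lemma fibLattice_sub_fibLattice_subset : fibLattice - fibLattice ⊆ fibLattice := by
  rintro _ ⟨_, ⟨m, n, rfl⟩, _, ⟨m', n', rfl⟩, rfl⟩
  refine ⟨m - m', n - n', ?_⟩
  ext <;> push_cast <;> simp only [Prod.mk_sub_mk] <;> ring

lemma fib_sub_fib_subset :
    Fib - Fib ⊆ modelSet fibLattice (Set.Icc (-Real.goldenRatio) Real.goldenRatio) := by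
  refine (modelSet_sub_modelSet_subset fibLattice_sub_fibLattice_subset _ _).trans
    (modelSet_mono _ ?_)
  rintro _ ⟨y, hy, y', hy', rfl⟩
  constructor <;> linarith [hy.1, hy.2, hy'.1, hy'.2]

lemma dualStar_spec {J : Set ℝ} {k : ℝ} (hk : k ∈ dualModelSet J) :
    (k, dualStar k) ∈ dualLattice fibLattice ∧ dualStar k ∈ J := by
  obtain ⟨m, n, rfl, hJ⟩ := (mem_dualModelSet_iff J k).1 hk
  rw [dualStar_eq]
  exact ⟨(mem_dualLattice_fib_iff _).2 ⟨m, n, rfl⟩, hJ⟩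

lemma IsAutocorrelation.ae_mem {A : ℕ → Set ℝ} {Λ : Set ℝ} {γ : Measure ℝ}
    (h : IsAutocorrelation A Λ γ) {s : Set ℝ} (hs : MeasurableSet s) (hΛ : Λ - Λ ⊆ s) :
    ∀ᵐ x ∂γ, x ∈ s := by
  obtain ⟨η, -, rfl⟩ := h
  refine (Measure.ae_sum_iff' hs).2 fun z => Measure.ae_smul_measure ?_ _
  exact (ae_dirac_iff hs).2 (hΛ z.2)

lemma IsAutocorrelation.ae_mem_modelSet_of_subset_fib {A : ℕ → Set ℝ} {Λ : Set ℝ} {γ : Measure ℝ}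
    (h : IsAutocorrelation A Λ γ) (hΛ : Λ ⊆ Fib) :
    ∀ᵐ x ∂γ, x ∈ modelSet fibLattice (Set.Icc (-Real.goldenRatio) Real.goldenRatio) :=
  h.ae_mem (countable_modelSet countable_fibLattice _).measurableSet
    ((Set.sub_subset_sub hΛ hΛ).trans fib_sub_fib_subset)

end Fibonacci

end FibDiffraction

end

theorem mainTheorem7_general {L : Set (ℝ × ℝ)} {d : ℝ} {γ γhat : Measure ℝ}
    (hγ : ∀ᵐ x ∂γ, x ∈ FibDiffraction.modelSet L (Set.Icc (-d) d))
    (hγhat : FibDiffraction.IsFourierTransform γ γhat)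
    (h0 : FibDiffraction.HasBraggPeak γhat 0) {k l : ℝ}
    (hkl : (k, l) ∈ FibDiffraction.dualLattice L) (hl : 2 * Real.pi * |l| * d < 1) :
    FibDiffraction.HasBraggPeak γhat k ∧
      γhat.real {k} ≥ (1 - 2 * Real.pi * |l| * d) * γhat.real {0} ∧
      (1 - 2 * Real.pi * |l| * d) * γhat.real {0} > 0 := by
  have := hγhat.locallyFinite
  have hI : 0 < γhat.real {0} :=
    ENNReal.toReal_pos h0.ne' isCompact_singleton.measure_lt_top.ne
  have hpos := mul_pos (sub_pos.2 hl) hI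
  have hcos : ∀ᵐ x ∂γ, 1 - 2 * Real.pi * |l| * d ≤ Real.cos (2 * Real.pi * k * x) := by
    filter_upwards [hγ] with x hx using FibDiffraction.one_sub_le_cos_of_mem_modelSet hx hkl
  have hge := hγhat.mul_measureReal_singleton_zero_le hcos
  exact ⟨(ENNReal.toReal_pos_iff.1 (hpos.trans_le hge)).1, hge, hpos⟩

theorem mainTheorem7 (Λ : Set ℝ) (hΛ : Λ ⊆ FibDiffraction.Fib)
    (A : ℕ → Set ℝ) (hA : FibDiffraction.IsVanHove A)
    (γhat : Measure ℝ) (hγ : FibDiffraction.IsDiffraction A Λ γhat)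
    (h0 : FibDiffraction.HasBraggPeak γhat 0)
    (k : ℝ)
    (hk : k ∈ FibDiffraction.dualModelSet
      (Set.Ioo (-(1 / (2 * Real.pi * Real.goldenRatio))) (1 / (2 * Real.pi * Real.goldenRatio)))) :
    FibDiffraction.HasBraggPeak γhat k ∧
      γhat.real {k} ≥
        (1 - 2 * Real.pi * |FibDiffraction.dualStar k| * Real.goldenRatio) * γhat.real {0} ∧
      (1 - 2 * Real.pi * |FibDiffraction.dualStar k| * Real.goldenRatio) * γhat.real {0} > 0 := by
  obtain ⟨γ, hauto, hfour⟩ := hγ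
  obtain ⟨hdual, hstar⟩ := FibDiffraction.dualStar_spec hk
  rw [Set.mem_Ioo, ← abs_lt, lt_div_iff₀ (by positivity)] at hstar
  exact mainTheorem7_general (hauto.ae_mem_modelSet_of_subset_fib hΛ) hfour h0 hdual
    (by linarith)
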